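/- Let $\Bbbk$ be a field. For a topological space $X$ let $\mathrm{H}^*(X)=\bigoplus_{n\ge 0}\mathrm{H}^n(X;\Bbbk)$ be its singular cohomology ring with the cup product, and for a continuous map $f$ let $f^*$ be the induced ring homomorphism. Let $\Delta_X:X\to X\times X$, $\Delta_X(x)=(x,x)$, be the diagonal map. For an ideal $I$ of a ring let $\operatorname{nil}(I)\in\mathbb{N}\cup\{\infty\}$ be the smallest integer $n\ge 0$ with $I^{n+1}=0$, or $\infty$ if there is none. The zero-divisor-cup-length of a topological space $X$ is $$\mathbf{zcl}(X)=\operatorname{nil}\bigl(\ker(\Delta_X^*:\mathrm{H}^*(X\times X)\to \mathrm{H}^*(X))\bigr),$$ and that of a continuous map $f:X\to Y$ is $$\mathbf{zcl}(f)=\operatorname{nil}\bigl(\operatorname{im}((f\times f)^*)\cap\ker(\Delta_X^*)\bigr),$$ where $(f\times f)^*:\mathrm{H}^*(Y\times Y)\to\mathrm{H}^*(X\times X)$ and $\operatorname{im}((f\times f)^*)\cap\ker(\Delta_X^*)$ is regarded as an ideal of the ring $\operatorname{im}((f\times f)^*)$. A categorical invariant of a category $\mathcal{C}$ is a map $\mathbf{I}:\operatorname{Ob}(\mathcal{C})\sqcup\operatorname{Mor}(\mathcal{C})\to\mathbb{N}\cup\{\infty\}$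 such that $\mathbf{I}(\operatorname{id}_X)=\mathbf{I}(X)$ for every object $X$, and $\mathbf{I}(h\circ g\circ f)\le\mathbf{I}(g)$ for all morphisms $X\xrightarrow{f}Y\xrightarrow{g}Z\xrightarrow{h}W$. Lemma. $\mathbf{zcl}$ is a categorical invariant of the category of topological spaces and continuous maps. In particular, $\mathbf{zcl}(\operatorname{id}_X)=\mathbf{zcl}(X)$ for every topological space $X$, and $\mathbf{zcl}(g\circ f)\le\min\{\mathbf{zcl}(f),\mathbf{zcl}(g)\}$ for all continuous maps $f:X\to Y$ and $g:Y\to Z$. -/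

import Mathlib

open CategoryTheory Opposite
open scoped DirectSum

universe u v

noncomputable section

/-! ### Singular cohomology with its cup product -/

namespace SSet

/-- The module of `n`-cochains of a simplicial set `S` with coefficients in `k`: all functions
from the `n`-simplices of `S` to `k`. -/
abbrev Cochain (k : Type v) (S : SSet.{u}) (n : ℕ) : Type (max u v) := S.obj (op (SimplexCategory.mk n)) → k

section Cochains

variable (k : Type v) [CommRing k]

/-- The coboundary operator `(d φ)(σ) = ∑ᵢ (-1)ⁱ φ(∂ᵢ σ)`. -/
def coboundary (S : SSet.{u}) (n : ℕ) : Cochain k S n →ₗ[k] Cochain k S (n + 1) :=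
  ∑ i : Fin (n + 2), (-1 : k) ^ (i : ℕ) • LinearMap.funLeft k k (fun σ => S.δ i σ)

lemma coboundary_apply (S : SSet.{u}) (n : ℕ) (φ : Cochain k S n) (σ : S.obj (op (SimplexCategory.mk (n + 1)))) :
    coboundary k S n φ σ = ∑ i : Fin (n + 2), (-1 : k) ^ (i : ℕ) * φ (S.δ i σ) := by
  simp [coboundary, LinearMap.sum_apply, LinearMap.funLeft_apply]

/-- The module `Zⁿ` of `n`-cocycles. -/
def cocycles (S : SSet.{u}) (n : ℕ) : Submodule k (Cochain k S n) :=
  LinearMap.ker (coboundary k S n)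

/-- The module `Bⁿ` of `n`-coboundaries. -/
def coboundaries (S : SSet.{u}) : (n : ℕ) → Submodule k (Cochain k S n)
  | 0 => ⊥
  | n + 1 => LinearMap.range (coboundary k S n)

lemma coboundary_coboundary (S : SSet.{u}) (n : ℕ) (φ : Cochain k S n) :
    coboundary k S (n + 1) (coboundary k S n φ) = 0 := by
  funext σ
  simp only [coboundary_apply, Finset.mul_sum, Pi.zero_apply, ← Finset.sum_product',
    Finset.univ_product_univ]
  let A : Finset (Fin (n + 3) × Fin (n + 2)) := {ij | (ij.1 : ℕ) ≤ (ij.2 : ℕ)}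
  rw [← Finset.sum_add_sum_compl A, ← eq_neg_iff_add_eq_zero, ← Finset.sum_neg_distrib]
  refine Finset.sum_bij
    (fun ij hij => (ij.2.succ, ij.1.castLT (lt_of_le_of_lt (Finset.mem_filter.mp hij).2 ij.2.2)))
    ?_ ?_ ?_ ?_
  · rintro ⟨i, j⟩ hij
    simp only [A, Finset.compl_filter, Finset.mem_filter_univ, Fin.val_succ,
      Fin.val_castLT] at hij ⊢
    lia
  · rintro ⟨i, j⟩ hij ⟨i', j'⟩ hij' h
    simp only [Prod.mk.injEq, Fin.ext_iff, Fin.val_succ, Fin.val_castLT] at h ⊢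
    lia
  · rintro ⟨i', j'⟩ hij'
    simp only [A, Finset.compl_filter, Finset.mem_filter_univ, not_le] at hij'
    refine ⟨(j'.castSucc, i'.pred (by rintro rfl; simp at hij')), ?_, ?_⟩
    · simp only [A, Finset.mem_filter_univ, Fin.val_castSucc, Fin.val_pred]
      lia
    · simp
  · rintro ⟨i, j⟩ hij
    have hij' : (i : ℕ) ≤ (j : ℕ) := (Finset.mem_filter.mp hij).2
    have hle : i ≤ j.castSucc := by simpa [Fin.le_def] using hij'
    dsimp only
    rw [SSet.δ_comp_δ''_apply hle]
    simp only [Fin.val_succ, Fin.val_castLT, pow_succ]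
    ring

lemma coboundaries_le_cocycles (S : SSet.{u}) (n : ℕ) :
    coboundaries k S n ≤ cocycles k S n := by
  cases n with
  | zero => exact bot_le
  | succ n =>
    rintro _ ⟨φ, rfl⟩
    exact coboundary_coboundary k S n φ

/-- The `n`-th cohomology module `Hⁿ(S; k) = Zⁿ / Bⁿ`. -/
def Cohomology (S : SSet.{u}) (n : ℕ) : Type (max u v) :=
  cocycles k S n ⧸ (coboundaries k S n).submoduleOf (cocycles k S n)

instance (S : SSet.{u}) (n : ℕ) : AddCommGroup (Cohomology k S n) :=
  inferInstanceAs (AddCommGroup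
    (cocycles k S n ⧸ (coboundaries k S n).submoduleOf (cocycles k S n)))

instance (S : SSet.{u}) (n : ℕ) : Module k (Cohomology k S n) :=
  inferInstanceAs (Module k
    (cocycles k S n ⧸ (coboundaries k S n).submoduleOf (cocycles k S n)))

variable {k} {S : SSet.{u}}

/-- The cup product of cochains (Alexander–Whitney formula), for `n = p + q`:
`(φ ⌣ ψ)(σ) = φ(σ|[v₀, …, v_p]) * ψ(σ|[v_p, …, v_{p+q}])`. -/
def cochainCup {p q n : ℕ} (h : p + q = n) (φ : Cochain k S p) (ψ : Cochain k S q) :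
    Cochain k S n :=
  fun σ => φ (S.map (SimplexCategory.subinterval 0 p (by lia)).op σ) *
    ψ (S.map (SimplexCategory.subinterval p q h.le).op σ)

lemma map_map_apply {a b c : SimplexCategory} (f : a ⟶ b) (g : b ⟶ c) (σ : S.obj (op c)) :
    S.map f.op (S.map g.op σ) = S.map (f ≫ g).op σ := by
  simp

lemma subinterval_comp {a b n : ℕ} (i j l : ℕ) (h₁ : i + a ≤ b) (h₂ : j + b ≤ n)
    (h₃ : l + a ≤ n) (h : l = i + j) :
    SimplexCategory.subinterval i a h₁ ≫ SimplexCategory.subinterval j b h₂ =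
      SimplexCategory.subinterval l a h₃ := by
  subst h
  ext x : 3
  apply Fin.ext
  change (x : ℕ) + i + j = x + (i + j)
  lia

lemma subinterval_self (n : ℕ) (h : 0 + n ≤ n) :
    SimplexCategory.subinterval 0 n h = 𝟙 (SimplexCategory.mk n) := by
  ext x : 3
  rfl

lemma subinterval_comp_δ_of_lt {a j n : ℕ} (i : Fin (n + 2)) (h : j + a ≤ n)
    (h' : j + a ≤ n + 1) (hi : j + a < i) :
    SimplexCategory.subinterval j a h ≫ SimplexCategory.δ i =
      SimplexCategory.subinterval j a h' := by
  ext x : 3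
  apply Fin.ext
  change ((i.succAbove ⟨x + j, _⟩ : Fin (n + 2)) : ℕ) = x + j
  rw [Fin.succAbove_of_castSucc_lt]
  · rfl
  · rw [Fin.lt_def]
    have := x.2
    simp at this ⊢
    lia

lemma subinterval_comp_δ_of_le {a j n : ℕ} (i : Fin (n + 2)) (h : j + a ≤ n)
    (h' : j + 1 + a ≤ n + 1) (hi : (i : ℕ) ≤ j) :
    SimplexCategory.subinterval j a h ≫ SimplexCategory.δ i =
      SimplexCategory.subinterval (j + 1) a h' := by
  ext x : 3
  apply Fin.ext
  change ((i.succAbove ⟨x + j, _⟩ : Fin (n + 2)) : ℕ) = x + (j + 1)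
  rw [Fin.succAbove_of_le_castSucc]
  · rfl
  · rw [Fin.le_def]
    simp
    lia

lemma subinterval_comp_δ_mid {a j n : ℕ} (i : Fin (n + 2)) (i' : Fin (a + 2)) (h : j + a ≤ n)
    (h' : j + (a + 1) ≤ n + 1) (hi : (i : ℕ) = j + i') :
    SimplexCategory.subinterval j a h ≫ SimplexCategory.δ i =
      SimplexCategory.δ i' ≫ SimplexCategory.subinterval j (a + 1) h' := by
  ext x : 3
  apply Fin.ext
  change ((i.succAbove ⟨x + j, _⟩ : Fin (n + 2)) : ℕ) = (i'.succAbove x : ℕ) + j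
  by_cases hx : (x : ℕ) < i'
  · rw [Fin.succAbove_of_castSucc_lt _ _ (by simp [Fin.lt_def]; lia),
      Fin.succAbove_of_castSucc_lt _ _ (by simpa [Fin.lt_def] using hx)]
    rfl
  · rw [Fin.succAbove_of_le_castSucc _ _ (by simp [Fin.le_def]; lia),
      Fin.succAbove_of_le_castSucc _ _ (by simpa [Fin.le_def] using hx)]
    simp
    lia

/-- The Leibniz rule `d(φ ⌣ ψ) = dφ ⌣ ψ + (-1)ᵖ φ ⌣ dψ`. -/
lemma coboundary_cochainCup {p q n : ℕ} (h : p + q = n) (h₁ : p + 1 + q = n + 1)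
    (h₂ : p + (q + 1) = n + 1) (φ : Cochain k S p) (ψ : Cochain k S q) :
    coboundary k S n (cochainCup h φ ψ) =
      cochainCup h₁ (coboundary k S p φ) ψ +
        (-1 : k) ^ p • cochainCup h₂ φ (coboundary k S q ψ) := by
  subst h
  funext σ
  have hδ : ∀ {m : ℕ} (i : Fin (m + 2)) (τ : S.obj (op (SimplexCategory.mk (m + 1)))),
      S.δ i τ = S.map (SimplexCategory.δ i).op τ := fun _ _ => rfl
  have hsplit : ∀ F : Fin (p + q + 2) → k, ∑ i, F i =
      ∑ i : Fin (p + 1), F ⟨i, by lia⟩ + ∑ j : Fin (q + 1), F ⟨p + 1 + j, by lia⟩ := by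
    intro F
    rw [← Equiv.sum_comp (finCongr (by lia : p + 1 + (q + 1) = p + q + 2)), Fin.sum_univ_add]
    rfl
  simp only [Pi.add_apply, Pi.smul_apply, smul_eq_mul, cochainCup, coboundary_apply, hδ,
    map_map_apply, hsplit]
  rw [Fin.sum_univ_castSucc (n := p + 1), Fin.sum_univ_succ (n := q + 1), add_mul, mul_add,
    mul_add, Finset.sum_mul, Finset.mul_sum, Finset.mul_sum]
  have e₁ : ∀ i : Fin (p + 1),
      (-1 : k) ^ ((⟨i, by lia⟩ : Fin (p + q + 2)) : ℕ) *
        (φ (S.map (SimplexCategory.subinterval 0 p (by lia) ≫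
          SimplexCategory.δ (⟨i, by lia⟩ : Fin (p + q + 2))).op σ) *
        ψ (S.map (SimplexCategory.subinterval p q le_rfl ≫
          SimplexCategory.δ (⟨i, by lia⟩ : Fin (p + q + 2))).op σ)) =
      (-1 : k) ^ (i.castSucc : ℕ) *
        φ (S.map (SimplexCategory.δ i.castSucc ≫
          SimplexCategory.subinterval 0 (p + 1) (by lia)).op σ) *
        ψ (S.map (SimplexCategory.subinterval (p + 1) q h₁.le).op σ) := by
    intro i
    rw [subinterval_comp_δ_mid (⟨i, by lia⟩ : Fin (p + q + 2)) i.castSucc (by lia) (by lia)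
        (by simp),
      subinterval_comp_δ_of_le (⟨i, by lia⟩ : Fin (p + q + 2)) le_rfl h₁.le
        (by simp; lia), mul_assoc]
    rfl
  have e₂ : ∀ j : Fin (q + 1),
      (-1 : k) ^ ((⟨p + 1 + j, by lia⟩ : Fin (p + q + 2)) : ℕ) *
        (φ (S.map (SimplexCategory.subinterval 0 p (by lia) ≫
          SimplexCategory.δ (⟨p + 1 + j, by lia⟩ : Fin (p + q + 2))).op σ) *
        ψ (S.map (SimplexCategory.subinterval p q le_rfl ≫
          SimplexCategory.δ (⟨p + 1 + j, by lia⟩ : Fin (p + q + 2))).op σ)) =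
      (-1 : k) ^ p * (φ (S.map (SimplexCategory.subinterval 0 p (by lia)).op σ) *
        ((-1 : k) ^ (j.succ : ℕ) * ψ (S.map (SimplexCategory.δ j.succ ≫
          SimplexCategory.subinterval p (q + 1) h₂.le).op σ))) := by
    intro j
    rw [subinterval_comp_δ_mid (⟨p + 1 + j, by lia⟩ : Fin (p + q + 2)) j.succ le_rfl h₂.le
        (by simp; lia),
      subinterval_comp_δ_of_lt (⟨p + 1 + j, by lia⟩ : Fin (p + q + 2)) (by lia) (by lia)
        (by simp; lia)]
    simp only [Fin.val_succ, pow_add, pow_one]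
    ring
  have e₃ : SimplexCategory.δ (Fin.last (p + 1)) ≫
      SimplexCategory.subinterval 0 (p + 1) (by lia : 0 + (p + 1) ≤ p + q + 1) =
      SimplexCategory.subinterval 0 p (by lia) := by
    ext x : 3
    apply Fin.ext
    change (((Fin.last (p + 1)).succAbove x : Fin (p + 2)) : ℕ) + 0 = x + 0
    simp
  have e₄ : SimplexCategory.δ (0 : Fin (q + 2)) ≫ SimplexCategory.subinterval p (q + 1) h₂.le =
      SimplexCategory.subinterval (p + 1) q h₁.le := by
    ext x : 3
    apply Fin.ext
    change (((0 : Fin (q + 2)).succAbove x : Fin (q + 2)) : ℕ) + p = x + (p + 1)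
    simp
    lia
  rw [Finset.sum_congr rfl fun i _ => e₁ i, Finset.sum_congr rfl fun j _ => e₂ j, e₃, e₄]
  simp only [Fin.val_last, Fin.val_zero, pow_succ, pow_zero]
  ring

lemma cochainCup_assoc {p q r s t n : ℕ} (h₁ : p + q = s) (h₂ : s + r = n) (h₃ : q + r = t)
    (h₄ : p + t = n) (φ : Cochain k S p) (ψ : Cochain k S q) (χ : Cochain k S r) :
    cochainCup h₂ (cochainCup h₁ φ ψ) χ = cochainCup h₄ φ (cochainCup h₃ ψ χ) := by
  subst h₁ h₂ h₃
  funext σ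
  simp only [cochainCup, map_map_apply, mul_assoc]
  rw [subinterval_comp 0 0 0 _ _ (by lia) rfl,
    subinterval_comp p 0 p _ _ (by lia) rfl,
    subinterval_comp 0 p p _ _ (by lia) (by lia),
    subinterval_comp q p (p + q) _ _ (by lia) (by lia)]

lemma cochainCup_add_left {p q n : ℕ} (h : p + q = n) (φ φ' : Cochain k S p)
    (ψ : Cochain k S q) :
    cochainCup h (φ + φ') ψ = cochainCup h φ ψ + cochainCup h φ' ψ := by
  funext σ
  simp [cochainCup, add_mul]

lemma cochainCup_add_right {p q n : ℕ} (h : p + q = n) (φ : Cochain k S p)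
    (ψ ψ' : Cochain k S q) :
    cochainCup h φ (ψ + ψ') = cochainCup h φ ψ + cochainCup h φ ψ' := by
  funext σ
  simp [cochainCup, mul_add]

lemma cochainCup_zero_left {p q n : ℕ} (h : p + q = n) (ψ : Cochain k S q) :
    cochainCup h (0 : Cochain k S p) ψ = 0 := by
  funext σ
  simp [cochainCup]

lemma cochainCup_zero_right {p q n : ℕ} (h : p + q = n) (φ : Cochain k S p) :
    cochainCup h φ (0 : Cochain k S q) = 0 := by
  funext σ
  simp [cochainCup]

lemma cochainCup_mem_cocycles {p q n : ℕ} (h : p + q = n) {φ : Cochain k S p}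
    {ψ : Cochain k S q} (hφ : φ ∈ cocycles k S p) (hψ : ψ ∈ cocycles k S q) :
    cochainCup h φ ψ ∈ cocycles k S n := by
  have hφ' : coboundary k S p φ = 0 := hφ
  have hψ' : coboundary k S q ψ = 0 := hψ
  change coboundary k S n (cochainCup h φ ψ) = 0
  rw [coboundary_cochainCup h (by lia) (by lia), hφ', hψ', cochainCup_zero_left,
    cochainCup_zero_right, smul_zero, add_zero]

lemma cochainCup_mem_coboundaries_left {p q n : ℕ} (h : p + q = n) {φ : Cochain k S p}
    {ψ : Cochain k S q} (hφ : φ ∈ coboundaries k S p) (hψ : ψ ∈ cocycles k S q) :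
    cochainCup h φ ψ ∈ coboundaries k S n := by
  cases p with
  | zero =>
    have hφ' : φ = 0 := hφ
    rw [hφ', cochainCup_zero_left]
    exact zero_mem _
  | succ p =>
    obtain ⟨φ', rfl⟩ := hφ
    have hψ' : coboundary k S q ψ = 0 := hψ
    obtain ⟨m, rfl⟩ : ∃ m, n = m + 1 := ⟨p + q, by lia⟩
    refine ⟨cochainCup (by lia : p + q = m) φ' ψ, ?_⟩
    rw [coboundary_cochainCup _ h (by lia), hψ', cochainCup_zero_right, smul_zero, add_zero]

lemma cochainCup_mem_coboundaries_right {p q n : ℕ} (h : p + q = n) {φ : Cochain k S p}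
    {ψ : Cochain k S q} (hφ : φ ∈ cocycles k S p) (hψ : ψ ∈ coboundaries k S q) :
    cochainCup h φ ψ ∈ coboundaries k S n := by
  cases q with
  | zero =>
    have hψ' : ψ = 0 := hψ
    rw [hψ', cochainCup_zero_right]
    exact zero_mem _
  | succ q =>
    obtain ⟨ψ', rfl⟩ := hψ
    have hφ' : coboundary k S p φ = 0 := hφ
    obtain ⟨m, rfl⟩ : ∃ m, n = m + 1 := ⟨p + q, by lia⟩
    have key : cochainCup h φ (coboundary k S q ψ') =
        coboundary k S m ((-1 : k) ^ p • cochainCup (by lia : p + q = m) φ ψ') := by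
      rw [map_smul, coboundary_cochainCup _ (by lia) h, hφ', cochainCup_zero_left, zero_add,
        smul_smul, ← mul_pow]
      simp
    rw [key]
    exact ⟨_, rfl⟩

/-- The class of a cocycle. -/
def Cohomology.mk {n : ℕ} (z : cocycles k S n) : Cohomology k S n :=
  Submodule.Quotient.mk z

lemma Cohomology.mk_eq_mk_iff {n : ℕ} (z w : cocycles k S n) :
    Cohomology.mk z = Cohomology.mk w ↔
      (z : Cochain k S n) - (w : Cochain k S n) ∈ coboundaries k S n := by
  exact Submodule.Quotient.eq ((coboundaries k S n).submoduleOf (cocycles k S n))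

/-- The cup product `Hᵖ × H^q → Hⁿ` for `n = p + q`. -/
def cup {p q n : ℕ} (h : p + q = n) : Cohomology k S p → Cohomology k S q → Cohomology k S n :=
  Quotient.map₂
    (fun z w => ⟨cochainCup h z.1 w.1, cochainCup_mem_cocycles h z.2 w.2⟩) (by
      intro z z' hz w w' hw
      have hz' : (z : Cochain k S p) - (z' : Cochain k S p) ∈ coboundaries k S p :=
        (Cohomology.mk_eq_mk_iff z z').1 (Quotient.sound hz)
      have hw' : (w : Cochain k S q) - (w' : Cochain k S q) ∈ coboundaries k S q :=
        (Cohomology.mk_eq_mk_iff w w').1 (Quotient.sound hw)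
      refine Quotient.exact ((Cohomology.mk_eq_mk_iff _ _).2 ?_)
      have key : cochainCup h z.1 w.1 - cochainCup h z'.1 w'.1 =
          cochainCup h (z.1 - z'.1) w.1 + cochainCup h z'.1 (w.1 - w'.1) := by
        funext σ
        simp only [cochainCup, Pi.sub_apply, Pi.add_apply]
        ring
      change cochainCup h z.1 w.1 - cochainCup h z'.1 w'.1 ∈ _
      rw [key]
      exact add_mem (cochainCup_mem_coboundaries_left h hz' w.2)
        (cochainCup_mem_coboundaries_right h z'.2 hw'))

lemma cup_mk {p q n : ℕ} (h : p + q = n) (z : cocycles k S p) (w : cocycles k S q) :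
    cup h (Cohomology.mk z) (Cohomology.mk w) =
      Cohomology.mk ⟨cochainCup h z.1 w.1, cochainCup_mem_cocycles h z.2 w.2⟩ :=
  rfl

lemma Cohomology.ind {n : ℕ} {P : Cohomology k S n → Prop}
    (h : ∀ z : cocycles k S n, P (Cohomology.mk z)) (a : Cohomology k S n) : P a :=
  Submodule.Quotient.induction_on _ a h

lemma cup_add_left {p q n : ℕ} (h : p + q = n) (a a' : Cohomology k S p)
    (b : Cohomology k S q) : cup h (a + a') b = cup h a b + cup h a' b := by
  induction a using Cohomology.ind with | h z => ?_
  induction a' using Cohomology.ind with | h z' => ?_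
  induction b using Cohomology.ind with | h w => ?_
  exact congrArg Cohomology.mk (Subtype.ext (cochainCup_add_left h z.1 z'.1 w.1))

lemma cup_add_right {p q n : ℕ} (h : p + q = n) (a : Cohomology k S p)
    (b b' : Cohomology k S q) : cup h a (b + b') = cup h a b + cup h a b' := by
  induction a using Cohomology.ind with | h z => ?_
  induction b using Cohomology.ind with | h w => ?_
  induction b' using Cohomology.ind with | h w' => ?_
  exact congrArg Cohomology.mk (Subtype.ext (cochainCup_add_right h z.1 w.1 w'.1))

lemma cup_zero_left {p q n : ℕ} (h : p + q = n) (b : Cohomology k S q) :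
    cup h (0 : Cohomology k S p) b = 0 := by
  simpa using cup_add_left h (0 : Cohomology k S p) 0 b

lemma cup_zero_right {p q n : ℕ} (h : p + q = n) (a : Cohomology k S p) :
    cup h a (0 : Cohomology k S q) = 0 := by
  simpa using cup_add_right h a (0 : Cohomology k S q) 0

lemma cup_assoc {p q r s t n : ℕ} (h₁ : p + q = s) (h₂ : s + r = n) (h₃ : q + r = t)
    (h₄ : p + t = n) (a : Cohomology k S p) (b : Cohomology k S q) (c : Cohomology k S r) :
    cup h₂ (cup h₁ a b) c = cup h₄ a (cup h₃ b c) := by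
  induction a using Cohomology.ind with | h x => ?_
  induction b using Cohomology.ind with | h y => ?_
  induction c using Cohomology.ind with | h z => ?_
  exact congrArg Cohomology.mk (Subtype.ext (cochainCup_assoc h₁ h₂ h₃ h₄ x.1 y.1 z.1))

variable (k S) in
/-- The unit class in `H⁰`: the class of the `0`-cochain with constant value `1`. -/
def cohomologyOne : Cohomology k S 0 :=
  Cohomology.mk ⟨fun _ => 1, by
    change coboundary k S 0 _ = 0
    funext σ
    simp [coboundary_apply, Fin.sum_univ_two]⟩

lemma cohomologyOne_cup {p : ℕ} (h : 0 + p = p) (a : Cohomology k S p) :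
    cup h (cohomologyOne k S) a = a := by
  induction a using Cohomology.ind with | h z => ?_
  refine congrArg Cohomology.mk (Subtype.ext ?_)
  funext σ
  simp [cochainCup, subinterval_self]

lemma cup_cohomologyOne {p : ℕ} (a : Cohomology k S p) :
    cup (Nat.add_zero p) a (cohomologyOne k S) = a := by
  induction a using Cohomology.ind with | h z => ?_
  refine congrArg Cohomology.mk (Subtype.ext ?_)
  funext σ
  simp [cochainCup, subinterval_self]

lemma sigma_cup_eq {p q m n : ℕ} (h : p + q = m) (h' : p + q = n) (a : Cohomology k S p)
    (b : Cohomology k S q) :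
    GradedMonoid.mk (A := Cohomology k S) m (cup h a b) = GradedMonoid.mk n (cup h' a b) := by
  subst h h'
  rfl

instance : GradedMonoid.GMul (Cohomology k S) where
  mul a b := cup rfl a b

instance : GradedMonoid.GOne (Cohomology k S) where
  one := cohomologyOne k S

instance : GradedMonoid.GMonoid (Cohomology k S) where
  one_mul := by
    rintro ⟨n, a⟩
    exact (sigma_cup_eq rfl (Nat.zero_add n) _ _).trans
      (congrArg (GradedMonoid.mk n) (cohomologyOne_cup _ a))
  mul_one := by
    rintro ⟨n, a⟩
    exact congrArg (GradedMonoid.mk n) (cup_cohomologyOne a)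
  mul_assoc := by
    rintro ⟨p, a⟩ ⟨q, b⟩ ⟨r, c⟩
    exact (congrArg (GradedMonoid.mk (p + q + r))
      (cup_assoc rfl rfl rfl (Nat.add_assoc p q r).symm a b c)).trans (sigma_cup_eq _ _ _ _)

/-- The cup product makes `⨁ n, Hⁿ(S; k)` a graded ring. -/
instance : DirectSum.GRing (Cohomology k S) where
  mul_zero a := cup_zero_right rfl a
  zero_mul b := cup_zero_left rfl b
  mul_add a b c := cup_add_right rfl a b c
  add_mul a b c := cup_add_left rfl a b c
  one_mul := GradedMonoid.GMonoid.one_mul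
  mul_one := GradedMonoid.GMonoid.mul_one
  mul_assoc := GradedMonoid.GMonoid.mul_assoc
  natCast n := n • cohomologyOne k S
  natCast_zero := zero_nsmul _
  natCast_succ n := succ_nsmul _ _
  intCast n := n • cohomologyOne k S
  intCast_ofNat n := natCast_zsmul _ n
  intCast_negSucc_ofNat n := negSucc_zsmul _ n

/-! ### Functoriality -/

variable {T : SSet.{u}}

/-- Pullback of cochains along a map of simplicial sets. -/
def cochainMap (f : S ⟶ T) (n : ℕ) : Cochain k T n →ₗ[k] Cochain k S n :=
  LinearMap.funLeft k k (fun σ => f.app (op (SimplexCategory.mk n)) σ)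

lemma cochainMap_apply (f : S ⟶ T) (n : ℕ) (φ : Cochain k T n)
    (σ : S.obj (op (SimplexCategory.mk n))) :
    cochainMap f n φ σ = φ (f.app (op (SimplexCategory.mk n)) σ) :=
  rfl

lemma coboundary_cochainMap (f : S ⟶ T) (n : ℕ) (φ : Cochain k T n) :
    coboundary k S n (cochainMap f n φ) = cochainMap f (n + 1) (coboundary k T n φ) := by
  funext σ
  simp only [coboundary_apply, cochainMap_apply]
  refine Finset.sum_congr rfl fun i _ => ?_
  congr 2
  exact NatTrans.naturality_apply f (SimplexCategory.δ i).op σ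

lemma cochainMap_mem_cocycles (f : S ⟶ T) (n : ℕ) {φ : Cochain k T n}
    (hφ : φ ∈ cocycles k T n) : cochainMap f n φ ∈ cocycles k S n := by
  have hφ' : coboundary k T n φ = 0 := hφ
  change coboundary k S n (cochainMap f n φ) = 0
  rw [coboundary_cochainMap, hφ', map_zero]

lemma cochainMap_mem_coboundaries (f : S ⟶ T) (n : ℕ) {φ : Cochain k T n}
    (hφ : φ ∈ coboundaries k T n) : cochainMap f n φ ∈ coboundaries k S n := by
  cases n with
  | zero =>
    have hφ' : φ = 0 := hφ
    rw [hφ', map_zero]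
    exact zero_mem _
  | succ n =>
    obtain ⟨φ', rfl⟩ := hφ
    exact ⟨cochainMap f n φ', coboundary_cochainMap f n φ'⟩

variable (k) in
/-- The map `f^* : Hⁿ(T; k) → Hⁿ(S; k)` induced by `f : S ⟶ T`. -/
def cohomologyMap (f : S ⟶ T) (n : ℕ) : Cohomology k T n →ₗ[k] Cohomology k S n :=
  Submodule.mapQ _ _ ((cochainMap f n).restrict fun _ => cochainMap_mem_cocycles f n)
    fun _ hz => cochainMap_mem_coboundaries f n hz

lemma cohomologyMap_one (f : S ⟶ T) :
    cohomologyMap k f 0 (cohomologyOne k T) = cohomologyOne k S :=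
  rfl

lemma cohomologyMap_cup (f : S ⟶ T) {p q n : ℕ} (h : p + q = n) (a : Cohomology k T p)
    (b : Cohomology k T q) :
    cohomologyMap k f n (cup h a b) = cup h (cohomologyMap k f p a) (cohomologyMap k f q b) := by
  induction a using Cohomology.ind with | h z => ?_
  induction b using Cohomology.ind with | h w => ?_
  refine congrArg Cohomology.mk (Subtype.ext ?_)
  funext σ
  change z.1 _ * w.1 _ = z.1 _ * w.1 _
  congr 2
  · exact congrArg z.1
      (NatTrans.naturality_apply f (SimplexCategory.subinterval 0 p (by lia)).op σ).symm
  · exact congrArg w.1 (NatTrans.naturality_apply f (SimplexCategory.subinterval p q h.le).op σ).symm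

variable (k) in
/-- The ring homomorphism `f^* : ⨁ n, Hⁿ(T; k) → ⨁ n, Hⁿ(S; k)` induced by `f : S ⟶ T`. -/
def cohomologyRingMap (f : S ⟶ T) :
    (⨁ n, Cohomology k T n) →+* (⨁ n, Cohomology k S n) :=
  DirectSum.toSemiring
    (fun n => (DirectSum.of (Cohomology k S) n).comp (cohomologyMap k f n).toAddMonoidHom)
    (congrArg (DirectSum.of (Cohomology k S) 0) (cohomologyMap_one f))
    (fun {i j} a b => by
      refine (congrArg (DirectSum.of (Cohomology k S) (i + j))
        (cohomologyMap_cup f rfl a b)).trans ?_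
      exact (DirectSum.of_mul_of _ _).symm)

end Cochains

end SSet

/-- The singular cohomology ring `H^*(X; k) = ⨁ n, Hⁿ(X; k)` of a topological space, with the cup
product. -/
abbrev SingularCohomologyRing (k : Type v) [CommRing k] (X : TopCat.{u}) : Type (max u v) :=
  ⨁ n, SSet.Cohomology k (TopCat.toSSet.obj X) n

/-- The ring homomorphism `f^* : H^*(Y; k) → H^*(X; k)` induced by a continuous map `f : X → Y`. -/
def singularPullback (k : Type v) [CommRing k] {X Y : TopCat.{u}} (f : X ⟶ Y) :
    SingularCohomologyRing k Y →+* SingularCohomologyRing k X :=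
  SSet.cohomologyRingMap k (TopCat.toSSet.map f)

/-! ### Nilpotency, zero-divisors and the zero-divisor-cup-length -/

/-- The nilpotency `nil I` of an ideal `I`: the smallest `n` with `I ^ (n + 1) = 0`, and `∞` if
there is no such `n`. -/
def idealNil {R : Type*} [Ring R] (I : Ideal R) : ℕ∞ :=
  ⨅ (n : ℕ) (_ : I ^ (n + 1) = ⊥), (n : ℕ∞)

/-- The diagonal map `Δ_X : X → X × X`. -/
def diagonalMap (X : TopCat.{u}) : X ⟶ TopCat.of (X × X) :=
  TopCat.ofHom ⟨fun x => (x, x), by fun_prop⟩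

/-- The map `f × f : X × X → Y × Y`. -/
def squareMap {X Y : TopCat.{u}} (f : X ⟶ Y) : TopCat.of (X × X) ⟶ TopCat.of (Y × Y) :=
  TopCat.ofHom (f.hom.prodMap f.hom)

/-- The ideal of zero-divisors of `H^*(X; k)`: the kernel of
`Δ_X^* : H^*(X × X; k) → H^*(X; k)`. -/
def zeroDivisorIdeal (k : Type v) [CommRing k] (X : TopCat.{u}) :
    Ideal (SingularCohomologyRing k (TopCat.of (X × X))) :=
  RingHom.ker (singularPullback k (diagonalMap X))

/-- The zero-divisor-cup-length of a space: `zcl(X) = nil (ker Δ_X^*)`. -/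
def zclSpace (k : Type v) [CommRing k] (X : TopCat.{u}) : ℕ∞ :=
  idealNil (zeroDivisorIdeal k X)

/-- The zero-divisor-cup-length of a map: `zcl(f) = nil (im (f × f)^* ∩ ker Δ_X^*)`, where
`im (f × f)^* ∩ ker Δ_X^*` is an ideal of the ring `im (f × f)^*`. -/
def zclMap (k : Type v) [CommRing k] {X Y : TopCat.{u}} (f : X ⟶ Y) : ℕ∞ :=
  idealNil ((zeroDivisorIdeal k X).comap (singularPullback k (squareMap f)).range.subtype)

/-- A categorical invariant of a category `C`, given by its values on objects and on morphisms. -/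
structure IsCategoricalInvariant (C : Type*) [Category C] (onObj : C → ℕ∞)
    (onHom : ∀ {X Y : C}, (X ⟶ Y) → ℕ∞) : Prop where
  map_id : ∀ X : C, onHom (𝟙 X) = onObj X
  map_comp_le : ∀ {X Y Z W : C} (f : X ⟶ Y) (g : Y ⟶ Z) (h : Z ⟶ W),
    onHom (f ≫ g ≫ h) ≤ onHom g

end

/-!
The first projection `X × X → X` is a retraction of the diagonal, so `Δ_Y^*` is split by `pr₁^*`,
naturally in `Y`. Hence a zero-divisor in the image of `(f × f)^*` lifts to a zero-divisor of `Y`: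
from a lift `a` subtract `pr₁^* (Δ_Y^* a)`, which `(f × f)^*` kills. It follows that
`im (f × f)^* ∩ ker Δ_X^* = (f × f)^* (ker Δ_Y^*)`, and `zcl(f)` is the least `n` for which
`(f × f)^*` kills `(ker Δ_Y^*) ^ (n + 1)`. In this form both comparisons follow from
functoriality, because `(g × g)^*` maps zero-divisors to zero-divisors.
-/

section Ideals

variable {R S : Type*} [Semiring R] [Semiring S]

lemma ideal_mul_le_comap_mul {φ : R →+* S} {I J : Ideal R} {K L : Ideal S}
    (hI : I ≤ K.comap φ) (hJ : J ≤ L.comap φ) : I * J ≤ (K * L).comap φ := by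
  rw [Ideal.mul_le]
  intro a ha b hb
  rw [Ideal.mem_comap, map_mul]
  exact Ideal.mul_mem_mul (hI ha) (hJ hb)

lemma ideal_pow_le_comap_pow {φ : R →+* S} {I : Ideal R} {K : Ideal S} (h : I ≤ K.comap φ)
    (n : ℕ) : I ^ n ≤ (K ^ n).comap φ := by
  induction n with
  | zero => simp only [Submodule.pow_zero, Ideal.one_eq_top, Ideal.comap_top, le_refl]
  | succ n ih =>
    rw [Submodule.pow_succ, Submodule.pow_succ]
    exact ideal_mul_le_comap_mul ih h

-- `Ideal.map_mul` and `Ideal.map_pow` ask for a commutative codomain; surjectivity replaces this.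
lemma ideal_map_mul_of_surjective {φ : R →+* S} (hφ : Function.Surjective φ) (I J : Ideal R) :
    (I * J).map φ = I.map φ * J.map φ := by
  apply le_antisymm
  · exact Ideal.map_le_iff_le_comap.2
      (ideal_mul_le_comap_mul Ideal.le_comap_map Ideal.le_comap_map)
  · rw [Ideal.mul_le]
    intro x hx y hy
    obtain ⟨a, ha, rfl⟩ := (Ideal.mem_map_iff_of_surjective φ hφ).1 hx
    obtain ⟨b, hb, rfl⟩ := (Ideal.mem_map_iff_of_surjective φ hφ).1 hy
    rw [← map_mul]
    exact Ideal.mem_map_of_mem φ (Ideal.mul_mem_mul ha hb)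

lemma ideal_map_pow_of_surjective {φ : R →+* S} (hφ : Function.Surjective φ) (I : Ideal R)
    (n : ℕ) : (I ^ n).map φ = I.map φ ^ n := by
  induction n with
  | zero => simp only [Submodule.pow_zero, Ideal.one_eq_top, Ideal.map_top]
  | succ n ih =>
    rw [Submodule.pow_succ, Submodule.pow_succ, ideal_map_mul_of_surjective hφ, ih]

end Ideals

lemma ideal_map_rangeRestrict_eq_comap_subtype {R S : Type*} [Ring R] [Ring S] {φ : R →+* S}
    {I : Ideal R} {J : Ideal S} (h : J.comap φ = I ⊔ RingHom.ker φ) :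
    I.map φ.rangeRestrict = J.comap φ.range.subtype := by
  apply Ideal.comap_injective_of_surjective φ.rangeRestrict φ.rangeRestrict_surjective
  rw [Ideal.comap_map_of_surjective _ φ.rangeRestrict_surjective, ← RingHom.ker_eq_comap_bot,
    RingHom.ker_rangeRestrict, ← h]
  rfl

lemma idealNil_map_of_surjective {R S : Type*} [Ring R] [Ring S] {φ : R →+* S}
    (hφ : Function.Surjective φ) (I : Ideal R) :
    idealNil (I.map φ) = ⨅ (n : ℕ) (_ : I ^ (n + 1) ≤ RingHom.ker φ), (n : ℕ∞) := by
  simp only [idealNil, ← ideal_map_pow_of_surjective hφ, Ideal.map_eq_bot_iff_le_ker]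

section Functoriality

variable (k : Type v) [CommRing k]

lemma cohomologyMap_id (S : SSet.{u}) (n : ℕ) :
    SSet.cohomologyMap k (𝟙 S) n = LinearMap.id := by
  ext a
  induction a using SSet.Cohomology.ind with | h z => rfl

lemma cohomologyMap_comp {S T U : SSet.{u}} (f : S ⟶ T) (g : T ⟶ U) (n : ℕ) :
    SSet.cohomologyMap k (f ≫ g) n = SSet.cohomologyMap k f n ∘ₗ SSet.cohomologyMap k g n := by
  ext a
  induction a using SSet.Cohomology.ind with | h z => rfl

lemma cohomologyRingMap_of {S T : SSet.{u}} (f : S ⟶ T) (n : ℕ) (a : SSet.Cohomology k T n) :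
    SSet.cohomologyRingMap k f (DirectSum.of (SSet.Cohomology k T) n a) =
      DirectSum.of (SSet.Cohomology k S) n (SSet.cohomologyMap k f n a) :=
  DirectSum.toSemiring_of _ _ _ _ _

lemma cohomologyRingMap_id (S : SSet.{u}) :
    SSet.cohomologyRingMap k (𝟙 S) = RingHom.id (⨁ n, SSet.Cohomology k S n) := by
  refine DirectSum.ringHom_ext fun n a => ?_
  rw [cohomologyRingMap_of, cohomologyMap_id, LinearMap.id_apply, RingHom.id_apply]

lemma cohomologyRingMap_comp {S T U : SSet.{u}} (f : S ⟶ T) (g : T ⟶ U) :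
    SSet.cohomologyRingMap k (f ≫ g) =
      (SSet.cohomologyRingMap k f).comp (SSet.cohomologyRingMap k g) := by
  refine DirectSum.ringHom_ext fun n a => ?_
  rw [RingHom.comp_apply, cohomologyRingMap_of, cohomologyRingMap_of, cohomologyRingMap_of,
    cohomologyMap_comp, LinearMap.comp_apply]

lemma singularPullback_id (X : TopCat.{u}) :
    singularPullback k (𝟙 X) = RingHom.id (SingularCohomologyRing k X) := by
  rw [singularPullback, CategoryTheory.Functor.map_id, cohomologyRingMap_id]

lemma singularPullback_comp {X Y Z : TopCat.{u}} (f : X ⟶ Y) (g : Y ⟶ Z) :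
    singularPullback k (f ≫ g) = (singularPullback k f).comp (singularPullback k g) := by
  rw [singularPullback, Functor.map_comp, cohomologyRingMap_comp]
  rfl

end Functoriality

section SquareMap

variable {X Y Z : TopCat.{u}}

lemma squareMap_id (X : TopCat.{u}) : squareMap (𝟙 X) = 𝟙 (TopCat.of (X × X)) := rfl

lemma squareMap_comp (f : X ⟶ Y) (g : Y ⟶ Z) :
    squareMap (f ≫ g) = squareMap f ≫ squareMap g := rfl

lemma diagonalMap_comp_prodFst (X : TopCat.{u}) : diagonalMap X ≫ TopCat.prodFst = 𝟙 X := rfl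

lemma diagonalMap_comp_squareMap (f : X ⟶ Y) :
    diagonalMap X ≫ squareMap f = f ≫ diagonalMap Y := rfl

lemma squareMap_comp_prodFst (f : X ⟶ Y) :
    squareMap f ≫ TopCat.prodFst = TopCat.prodFst ≫ f := rfl

end SquareMap

section ZeroDivisors

variable (k : Type v) [CommRing k] {X Y Z : TopCat.{u}}

lemma singularPullback_diagonalMap_squareMap (f : X ⟶ Y)
    (a : SingularCohomologyRing k (TopCat.of (Y × Y))) :
    singularPullback k (diagonalMap X) (singularPullback k (squareMap f) a) =
      singularPullback k f (singularPullback k (diagonalMap Y) a) := by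
  rw [← RingHom.comp_apply, ← RingHom.comp_apply, ← singularPullback_comp,
    ← singularPullback_comp, diagonalMap_comp_squareMap]

lemma singularPullback_diagonalMap_prodFst (a : SingularCohomologyRing k X) :
    singularPullback k (diagonalMap X) (singularPullback k TopCat.prodFst a) = a := by
  rw [← RingHom.comp_apply, ← singularPullback_comp, diagonalMap_comp_prodFst,
    singularPullback_id, RingHom.id_apply]

lemma singularPullback_squareMap_prodFst (f : X ⟶ Y) (a : SingularCohomologyRing k Y) :
    singularPullback k (squareMap f) (singularPullback k TopCat.prodFst a) =
      singularPullback k TopCat.prodFst (singularPullback k f a) := by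
  rw [← RingHom.comp_apply, ← RingHom.comp_apply, ← singularPullback_comp,
    ← singularPullback_comp, squareMap_comp_prodFst]

lemma zeroDivisorIdeal_le_comap_squareMap (f : X ⟶ Y) :
    zeroDivisorIdeal k Y ≤ (zeroDivisorIdeal k X).comap (singularPullback k (squareMap f)) := by
  intro a (ha : singularPullback k (diagonalMap Y) a = 0)
  rw [Ideal.mem_comap, zeroDivisorIdeal, RingHom.mem_ker, singularPullback_diagonalMap_squareMap,
    ha, map_zero]

lemma comap_squareMap_zeroDivisorIdeal (f : X ⟶ Y) :
    (zeroDivisorIdeal k X).comap (singularPullback k (squareMap f)) =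
      zeroDivisorIdeal k Y ⊔ RingHom.ker (singularPullback k (squareMap f)) := by
  refine le_antisymm (fun a ha => ?_) (sup_le (zeroDivisorIdeal_le_comap_squareMap k f)
    (Ideal.comap_mono bot_le))
  let s : SingularCohomologyRing k (TopCat.of (Y × Y)) :=
    singularPullback k TopCat.prodFst (singularPullback k (diagonalMap Y) a)
  have hsub : a - s ∈ zeroDivisorIdeal k Y := by
    rw [zeroDivisorIdeal, RingHom.mem_ker, map_sub, singularPullback_diagonalMap_prodFst, sub_self]
  have hs : s ∈ RingHom.ker (singularPullback k (squareMap f)) := by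
    rw [Ideal.mem_comap, zeroDivisorIdeal, RingHom.mem_ker,
      singularPullback_diagonalMap_squareMap] at ha
    rw [RingHom.mem_ker, singularPullback_squareMap_prodFst, ha, map_zero]
  exact sub_add_cancel a s ▸ Submodule.add_mem_sup hsub hs

lemma zclMap_eq_iInf (f : X ⟶ Y) :
    zclMap k f = ⨅ (n : ℕ)
      (_ : zeroDivisorIdeal k Y ^ (n + 1) ≤ RingHom.ker (singularPullback k (squareMap f))),
      (n : ℕ∞) := by
  rw [zclMap, ← ideal_map_rangeRestrict_eq_comap_subtype (comap_squareMap_zeroDivisorIdeal k f),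
    idealNil_map_of_surjective (RingHom.rangeRestrict_surjective _), RingHom.ker_rangeRestrict]

lemma zclMap_id (X : TopCat.{u}) : zclMap k (𝟙 X) = zclSpace k X := by
  have hker : RingHom.ker (singularPullback k (squareMap (𝟙 X))) = ⊥ := by
    rw [squareMap_id, singularPullback_id]
    exact (RingHom.injective_iff_ker_eq_bot _).1 Function.injective_id
  simp only [zclMap_eq_iInf, hker, le_bot_iff, zclSpace, idealNil]

lemma zclMap_comp_le_left (f : X ⟶ Y) (g : Y ⟶ Z) : zclMap k (f ≫ g) ≤ zclMap k f := by
  simp only [zclMap_eq_iInf]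
  refine le_iInf₂ fun n hn => iInf₂_le n ?_
  rw [squareMap_comp, singularPullback_comp, ← RingHom.comap_ker]
  calc zeroDivisorIdeal k Z ^ (n + 1)
      ≤ (zeroDivisorIdeal k Y ^ (n + 1)).comap (singularPullback k (squareMap g)) :=
        ideal_pow_le_comap_pow (zeroDivisorIdeal_le_comap_squareMap k g) (n + 1)
    _ ≤ (RingHom.ker (singularPullback k (squareMap f))).comap
          (singularPullback k (squareMap g)) := Ideal.comap_mono hn

lemma zclMap_comp_le_right (f : X ⟶ Y) (g : Y ⟶ Z) : zclMap k (f ≫ g) ≤ zclMap k g := by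
  simp only [zclMap_eq_iInf]
  refine le_iInf₂ fun n hn => iInf₂_le n ?_
  rw [squareMap_comp, singularPullback_comp, ← RingHom.comap_ker]
  exact hn.trans (Ideal.comap_mono bot_le)

end ZeroDivisors

theorem mainTheorem5_general (k : Type v) [CommRing k] :
    IsCategoricalInvariant TopCat.{u} (fun X => zclSpace k X) (fun f => zclMap k f) ∧
      (∀ X : TopCat.{u}, zclMap k (𝟙 X) = zclSpace k X) ∧
      (∀ {X Y Z : TopCat.{u}} (f : X ⟶ Y) (g : Y ⟶ Z),
        zclMap k (f ≫ g) ≤ min (zclMap k f) (zclMap k g)) := by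
  refine ⟨⟨zclMap_id k, fun f g h => ?_⟩, zclMap_id k, fun f g =>
    le_min (zclMap_comp_le_left k f g) (zclMap_comp_le_right k f g)⟩
  calc zclMap k (f ≫ g ≫ h)
      ≤ zclMap k (g ≫ h) := zclMap_comp_le_right k f (g ≫ h)
    _ ≤ zclMap k g := zclMap_comp_le_left k g h

theorem mainTheorem5 (k : Type v) [Field k] :
    IsCategoricalInvariant TopCat.{u} (fun X => zclSpace k X) (fun f => zclMap k f) ∧
      (∀ X : TopCat.{u}, zclMap k (𝟙 X) = zclSpace k X) ∧
      (∀ {X Y Z : TopCat.{u}} (f : X ⟶ Y) (g : Y ⟶ Z),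
        zclMap k (f ≫ g) ≤ min (zclMap k f) (zclMap k g)) :=
  mainTheorem5_general k
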